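/- Let $G$ be a finite abelian group of order $n$. For $g\in G$ let $\mathbb B(g)\in M_n(\mathbb F_2)$ be the permutation matrix with rows and columns indexed by $G$ and $\mathbb B(g)_{x,y}=1$ if and only if $x=gy$. Let $a,b\in\mathbb F_2[G]$, $a=\sum_g a_g g$, $b=\sum_g b_g g$, and put $\mathbf A=\sum_g a_g\mathbb B(g)$, $\mathbf B=\sum_g b_g\mathbb B(g)$. The Abelian two-block group algebra (2BGA) code of $(a,b)$ is the quantum CSS code of length $2n$ with parity-check matrices $\mathbf H_X=[\mathbf A\,|\,\mathbf B]$ and $\mathbf H_Z=[\mathbf B^{\intercal}\,|\,\mathbf A^{\intercal}]$, whose rows are the stabilizer generators. Its dimension is $k=2n-\operatorname{rank}\mathbf H_X-\operatorname{rank}\mathbf H_Z$, and its minimum distance $d$ is the minimum of $d_X$ and $d_Z$, where $d_X$ (resp. $d_Z$) is the smallest Hamming weight of a vector of $\ker\mathbf H_X$ (resp. $\ker\mathbf H_Z$) that is not in the row space of $\mathbf H_Z$ (resp. $\mathbf H_X$). For $D\ge 1$ let $$\gamma_D=\max_{\Lambda}\ \min_{0\neq x\in\Lambda}\left(\frac{\|x\|}{\mathrm{vol}(\Lambda)^{1/D}}\right)^2$$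 be the $D$-dimensional Hermite constant, where $\Lambda$ runs over the full-rank lattices of Euclidean space $\mathbb R^D$. Suppose that the code is non-trivial, i.e. that $\mathbf A\neq 0$ or $\mathbf B\neq 0$, that $k\ge 1$ (so that the minimum distance is defined), and that all stabilizer generators have weight $w\ge 3$. Put $D=w-2$. If $n^{1/D}\ge 8\sqrt{\gamma_D}$, then $$d\le 2\sqrt{\gamma_D}\,\bigl(\sqrt D+4\bigr)\,n^{\frac{D-1}{D}}.$$ -/

import Mathlib

/-- The permutation matrix of the action of `g` on the group `G`, with entry `1` at `(x, y)` exactly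
when `x = g * y`. -/
def groupPermMatrix {G : Type*} [CommGroup G] [DecidableEq G] (g : G) : Matrix G G (ZMod 2) :=
  Matrix.of fun x y => if x = g * y then 1 else 0

/-- The binary matrix `∑ g, a g • 𝔹(g)` of the element `∑ g, a g • g` of the group algebra `𝔽₂[G]`. -/
def groupAlgebraMatrix {G : Type*} [CommGroup G] [Fintype G] [DecidableEq G] (a : G → ZMod 2) :
    Matrix G G (ZMod 2) :=
  ∑ g, a g • groupPermMatrix g

theorem groupAlgebraMatrix_apply {G : Type*} [CommGroup G] [Fintype G] [DecidableEq G]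
    (a : G → ZMod 2) (x y : G) : groupAlgebraMatrix a x y = a (x * y⁻¹) := by
  have h : ∀ g : G, (x = g * y) ↔ (x * y⁻¹ = g) := fun g => by
    rw [mul_inv_eq_iff_eq_mul]
  simp [groupAlgebraMatrix, groupPermMatrix, Matrix.sum_apply, h]

theorem groupAlgebraMatrix_mul_comm {G : Type*} [CommGroup G] [Fintype G] [DecidableEq G]
    (a b : G → ZMod 2) :
    groupAlgebraMatrix a * groupAlgebraMatrix b = groupAlgebraMatrix b * groupAlgebraMatrix a := by
  ext x y
  simp only [Matrix.mul_apply, groupAlgebraMatrix_apply]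
  refine Fintype.sum_equiv ((Equiv.inv G).trans (Equiv.mulLeft (x * y))) _ _ fun z => ?_
  have h1 : x * (x * y * z⁻¹)⁻¹ = z * y⁻¹ := by
    simp only [mul_inv_rev, inv_inv]
    rw [mul_comm y⁻¹ x⁻¹, mul_left_comm z, mul_inv_cancel_left]
  have h2 : x * y * z⁻¹ * y⁻¹ = x * z⁻¹ := by
    rw [mul_right_comm, mul_inv_cancel_right]
  simp only [Equiv.trans_apply, Equiv.inv_apply, Equiv.coe_mulLeft, h1, h2]
  exact mul_comm _ _

/-- A (presented) quantum CSS code: the qubits are indexed by `Q`, and the rows of `HX` and of `HZ`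
are the stabilizer generators of type `X` and of type `Z`, which commute. -/
structure CSSCode (R Q : Type*) [Fintype Q] where
  /-- The parity-check matrix of the generators of type `X`. -/
  HX : Matrix R Q (ZMod 2)
  /-- The parity-check matrix of the generators of type `Z`. -/
  HZ : Matrix R Q (ZMod 2)
  /-- The generators commute. -/
  comm : HX * HZ.transpose = 0

namespace CSSCode

variable {R Q : Type*} [Fintype Q]

/-- The number `k = N - rank HX - rank HZ` of logical qubits (since `HX * HZᵀ = 0`, the
subtraction never truncates). -/
noncomputable def dimension (C : CSSCode R Q) : ℕ :=
  Fintype.card Q - C.HX.rank - C.HZ.rank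

/-- `d_X`: the smallest Hamming weight of a vector of `ker HX` which is not in the row space of `HZ`
(`⊤` if there is none). Such a vector is automatically nonzero. -/
noncomputable def distX (C : CSSCode R Q) : ℕ∞ :=
  ⨅ v ∈ {v : Q → ZMod 2 | C.HX.mulVec v = 0 ∧ v ∉ Submodule.span (ZMod 2) (Set.range C.HZ.row)},
    (hammingNorm v : ℕ∞)

/-- `d_Z`: the smallest Hamming weight of a vector of `ker HZ` which is not in the row space of `HX`
(`⊤` if there is none). Such a vector is automatically nonzero. -/
noncomputable def distZ (C : CSSCode R Q) : ℕ∞ :=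
  ⨅ v ∈ {v : Q → ZMod 2 | C.HZ.mulVec v = 0 ∧ v ∉ Submodule.span (ZMod 2) (Set.range C.HX.row)},
    (hammingNorm v : ℕ∞)

/-- The minimum distance `min(d_X, d_Z)`; it is finite as soon as there is a logical qubit. -/
noncomputable def minDistance (C : CSSCode R Q) : ℕ∞ :=
  min C.distX C.distZ

/-- All stabilizer generators have Hamming weight `w`. -/
def HasGeneratorWeight (C : CSSCode R Q) (w : ℕ) : Prop :=
  ∀ i, hammingNorm (C.HX.row i) = w ∧ hammingNorm (C.HZ.row i) = w

end CSSCode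

/-- The Abelian two-block group algebra code of `a, b ∈ 𝔽₂[G]`, with parity-check matrices
`HX = [A | B]` and `HZ = [Bᵀ | Aᵀ]`; its qubits are indexed by two copies of `G`. -/
def abelian2BGA {G : Type*} [CommGroup G] [Fintype G] [DecidableEq G] (a b : G → ZMod 2) :
    CSSCode G (G ⊕ G) where
  HX := Matrix.fromCols (groupAlgebraMatrix a) (groupAlgebraMatrix b)
  HZ := Matrix.fromCols (groupAlgebraMatrix b).transpose (groupAlgebraMatrix a).transpose
  comm := by
    rw [Matrix.transpose_fromCols, Matrix.transpose_transpose, Matrix.transpose_transpose,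
      Matrix.fromCols_mul_fromRows, groupAlgebraMatrix_mul_comm b a]
    ext x y
    exact CharTwo.add_self_eq_zero _

/-- The Hermite invariant of a full-rank lattice `L` of `ℝ^D`: the smallest value of
`(‖x‖ / vol(L)^(1/D))²` over the nonzero `x ∈ L`. -/
noncomputable def hermiteInvariant {D : ℕ} (L : Submodule ℤ (EuclideanSpace ℝ (Fin D))) : ℝ :=
  sInf {t : ℝ | ∃ x ∈ L, x ≠ 0 ∧ t = (‖x‖ / ZLattice.covolume L ^ ((1 : ℝ) / D)) ^ 2}

/-- The Hermite constant `γ_D` (for `1 ≤ D`): the largest Hermite invariant of a full-rank lattice of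
`ℝ^D`. -/
noncomputable def hermiteConstant (D : ℕ) : ℝ :=
  sSup {t : ℝ | ∃ (L : Submodule ℤ (EuclideanSpace ℝ (Fin D))) (_ : DiscreteTopology L),
    IsZLattice ℝ L ∧ t = hermiteInvariant L}

/-! The distance is bounded by cleaning. Split the qubits into two parts, each divided into cells of
at most `m` qubits such that no X check meets two cells of the first part and no Z check two cells
of the second. If the distance exceeded `m`, a kernel vector supported in its part would split into
cell-sized kernel vectors, each a stabilizer; then neither part supports a logical operator of its
type, and duality forces `k = 0` (`card_le_rank_add_rank`, `minDistance_le_of_cells`).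

The cells come from a character. Translating the supports of `a` and `b` so that both contain `1`
leaves at most `w - 2 = D` other elements, and every check becomes a unit ball in the Cayley graph
they define. Let `H` be the subgroup they generate. The logarithms of the characters of `H` on these
generators form a lattice containing `ℤ^D` with index at least `|H|`, so the Hermite constant gives
a nontrivial character within `ε = √γ_D |H|^(-1/D)` of `1` on each generator
(`exists_monoidHom_circle_near_one`). Cutting the circle into an even number of arcs of length
between `2ε` and `4ε` and colouring them alternately gives the two parts
(`exists_separated_strips`). A strip has at most `5ε|H|` points, each carrying two qubits, whence `d
≤ 10√γ_D n^((D-1)/D)`; finally `10 ≤ 2(√D + 4)`. -/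

/-! ### Cleaning: from cells to a distance bound. -/

/-- Restricting `v` to a cell keeps it in the kernel, since a check sees at most one cell of `e`; so
`v` is a sum of kernel vectors of weight at most `m`. -/
theorem mem_span_of_support_subset {R Q ι : Type*} [Fintype Q]
    (H : Matrix R Q (ZMod 2)) (S : Submodule (ZMod 2) (Q → ZMod 2)) (m : ℕ)
    (hS : ∀ v, H.mulVec v = 0 → hammingNorm v ≤ m → v ∈ S)
    (e : Q → Prop) (c : Q → ι)
    (hc : ∀ i q q', H i q ≠ 0 → H i q' ≠ 0 → e q → e q' → c q = c q')
    (hm : ∀ k, Nat.card {q // e q ∧ c q = k} ≤ m)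
    (v : Q → ZMod 2) (hv : H.mulVec v = 0) (hve : ∀ q, ¬ e q → v q = 0) : v ∈ S := by
  classical
  have hsum : v = ∑ k ∈ Finset.univ.image c, fun q => if c q = k then v q else 0 := by
    ext q
    simp [Finset.sum_apply]
  rw [hsum]
  refine S.sum_mem fun k _ => hS _ ?_ ?_
  · ext i
    simp only [Matrix.mulVec, dotProduct, Pi.zero_apply]
    -- If row `i` meets cell `k`, it sees the same of the restriction as of `v`; otherwise it sees
    -- nothing.
    by_cases h : ∃ q, H i q ≠ 0 ∧ e q ∧ c q = k
    · obtain ⟨q₀, h1, h2, h3⟩ := h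
      have hvi : H.mulVec v i = 0 := congrFun hv i
      simp only [Matrix.mulVec, dotProduct] at hvi
      refine (Finset.sum_congr rfl fun q _ => ?_).trans hvi
      by_cases hq : H i q = 0
      · simp [hq]
      by_cases hqe : e q
      · rw [if_pos ((hc i q q₀ hq h1 hqe h2).trans h3)]
      · simp [hve q hqe]
    · push Not at h
      refine Finset.sum_eq_zero fun q _ => ?_
      by_cases hq : H i q = 0
      · simp [hq]
      by_cases hqe : e q
      · rw [if_neg (h q hq hqe), mul_zero]
      · simp [hve q hqe]
  · refine le_trans ?_ (hm k)
    rw [Nat.card_eq_fintype_card, Fintype.card_subtype]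
    refine Finset.card_le_card fun q hq => ?_
    simp only [Finset.mem_filter, Finset.mem_univ, true_and, ne_eq, ite_eq_right_iff,
      Classical.not_imp] at hq ⊢
    exact ⟨by_contra fun h => hq.2 (hve q h), hq.1⟩

theorem finrank_span_row {R Q : Type*} [Fintype R] [Fintype Q] (H : Matrix R Q (ZMod 2)) :
    Module.finrank (ZMod 2) (Submodule.span (ZMod 2) (Set.range H.row)) = H.rank :=
  (H.rank_eq_finrank_span_row).symm

/-- The cleaning lemma: if no `X`-logical is supported inside `e` and no `Z`-logical is supported
outside `e`, then the code has no logical qubit. -/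
theorem card_le_rank_add_rank {R Q : Type*} [Fintype R] [Fintype Q]
    (HX HZ : Matrix R Q (ZMod 2)) (hcomm : HX * HZ.transpose = 0) (e : Q → Prop)
    (hX : ∀ v, HX.mulVec v = 0 → (∀ q, ¬ e q → v q = 0) →
      v ∈ Submodule.span (ZMod 2) (Set.range HZ.row))
    (hZ : ∀ v, HZ.mulVec v = 0 → (∀ q, e q → v q = 0) →
      v ∈ Submodule.span (ZMod 2) (Set.range HX.row)) :
    Fintype.card Q ≤ HX.rank + HZ.rank := by
  classical
  let B : LinearMap.BilinForm (ZMod 2) (Q → ZMod 2) := Matrix.toBilin' 1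
  have hBapp : ∀ u v, B u v = u ⬝ᵥ v := fun u v => by
    simp [B, Matrix.toBilin'_apply']
  have hrefl : B.IsRefl := fun u v h => by
    rw [hBapp] at h ⊢
    rwa [dotProduct_comm]
  have hnd : B.Nondegenerate := Matrix.Nondegenerate.toBilin' (Matrix.nondegenerate_of_det_ne_zero (by simp))
  have hspan : ∀ (H : Matrix R Q (ZMod 2)) (v : Q → ZMod 2),
      v ∈ B.orthogonal (Submodule.span (ZMod 2) (Set.range H.row)) ↔ H.mulVec v = 0 := by
    intro H v
    rw [LinearMap.BilinForm.mem_orthogonal_iff]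
    constructor
    · intro h
      ext i
      have := h (H.row i) (Submodule.subset_span ⟨i, rfl⟩)
      rwa [hBapp] at this
    · intro h u hu
      induction hu using Submodule.span_induction with
      | mem x hx => obtain ⟨i, rfl⟩ := hx; rw [hBapp]; exact congrFun h i
      | zero => simp
      | add x y _ _ hx hy => simp [hx, hy]
      | smul r x _ hx => simp [hx]
  set SX := Submodule.span (ZMod 2) (Set.range HX.row) with hSX
  set SZ := Submodule.span (ZMod 2) (Set.range HZ.row) with hSZ
  let F : (Q → Prop) → Submodule (ZMod 2) (Q → ZMod 2) := fun p =>
    { carrier := {v | ∀ q, ¬ p q → v q = 0}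
      add_mem' := fun {u v} hu hv q hq => by simp [hu q hq, hv q hq]
      zero_mem' := fun q _ => rfl
      smul_mem' := fun r v hv q hq => by simp [hv q hq] }
  have hF : B.orthogonal (F fun q => ¬ e q) = F e := by
    ext v
    rw [LinearMap.BilinForm.mem_orthogonal_iff]
    constructor
    · intro h q hq
      have := h (Pi.single q 1) fun q' hq' => by
        rw [Pi.single_apply, if_neg]
        rintro rfl
        exact hq' hq
      rw [hBapp] at this
      simpa using this
    · intro h u hu
      rw [hBapp]
      refine Finset.sum_eq_zero fun q _ => ?_
      by_cases hq : e q
      · rw [hu q (not_not.2 hq), zero_mul]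
      · rw [h q hq, mul_zero]
  have hle : SX ≤ B.orthogonal SZ := by
    refine Submodule.span_le.2 ?_
    rintro _ ⟨i, rfl⟩
    refine (hspan HZ _).2 ?_
    ext j
    have : (HX * HZ.transpose) i j = 0 := congrFun (congrFun hcomm i) j
    rw [Matrix.mul_apply] at this
    simp only [Matrix.mulVec, dotProduct, Matrix.row, Pi.zero_apply]
    rw [← this]
    exact Finset.sum_congr rfl fun q _ => mul_comm _ _
  -- By modularity, nested subspaces with the same meet and join with a third one coincide; the
  -- third is the space of vectors supported outside `e`. `hZ` controls the meet and, after
  -- dualizing, `hX` the join.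
  have heq : SX = B.orthogonal SZ := by
    refine eq_of_le_of_inf_le_of_sup_le hle (z := F fun q => ¬ e q) ?_ ?_
    · rintro v ⟨h1, h2⟩
      exact ⟨hZ v ((hspan HZ v).1 h1) fun q hq => h2 q (not_not.2 hq), h2⟩
    · rw [← B.orthogonal_orthogonal hnd hrefl (SX ⊔ F fun q => ¬ e q)]
      have key : B.orthogonal (SX ⊔ F fun q => ¬ e q) ≤ SZ := by
        intro v hv
        refine hX v ((hspan HX v).1 (B.orthogonal_le le_sup_left hv)) ?_
        have := B.orthogonal_le le_sup_right hv
        rw [hF] at this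
        exact this
      refine sup_le (B.orthogonal_le key) ?_
      exact (B.le_orthogonal_orthogonal hrefl).trans
        (B.orthogonal_le (B.orthogonal_le le_sup_right))
  have h1 := LinearMap.BilinForm.finrank_orthogonal hnd SZ
  rw [← heq, hSX, hSZ, finrank_span_row, finrank_span_row, Module.finrank_fintype_fun_eq_card] at h1
  omega

namespace CSSCode

/-- If the qubits are split into two parts, and each part into cells of at most `m` qubits which
are separated by the generators of type `X`, respectively `Z`, then the distance is at most `m`. -/
theorem minDistance_le_of_cells {R Q ι : Type*} [Fintype R] [Fintype Q]
    (C : CSSCode R Q) (hdim : 0 < C.dimension) (m : ℕ) (e : Q → Prop) (c : Q → ι)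
    (hX : ∀ i q q', C.HX i q ≠ 0 → C.HX i q' ≠ 0 → e q → e q' → c q = c q')
    (hZ : ∀ i q q', C.HZ i q ≠ 0 → C.HZ i q' ≠ 0 → ¬ e q → ¬ e q' → c q = c q')
    (hmX : ∀ k, Nat.card {q // e q ∧ c q = k} ≤ m)
    (hmZ : ∀ k, Nat.card {q // ¬ e q ∧ c q = k} ≤ m) : C.minDistance ≤ m := by
  by_contra! hlt
  rw [minDistance, lt_min_iff] at hlt
  have h1 : ∀ v, C.HX.mulVec v = 0 → hammingNorm v ≤ m →
      v ∈ Submodule.span (ZMod 2) (Set.range C.HZ.row) := by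
    intro v hv hvm
    by_contra hn
    have : C.distX ≤ hammingNorm v := iInf₂_le v ⟨hv, hn⟩
    exact absurd (hlt.1.trans_le this) (by exact_mod_cast hvm.not_gt)
  have h2 : ∀ v, C.HZ.mulVec v = 0 → hammingNorm v ≤ m →
      v ∈ Submodule.span (ZMod 2) (Set.range C.HX.row) := by
    intro v hv hvm
    by_contra hn
    have : C.distZ ≤ hammingNorm v := iInf₂_le v ⟨hv, hn⟩
    exact absurd (hlt.2.trans_le this) (by exact_mod_cast hvm.not_gt)
  have := card_le_rank_add_rank C.HX C.HZ C.comm e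
    (mem_span_of_support_subset C.HX _ m h1 e c hX hmX)
    (fun v hv hve => mem_span_of_support_subset C.HZ _ m h2 (fun q => ¬ e q) c hZ hmZ v hv
      fun q hq => hve q (not_not.1 hq))
  rw [dimension] at hdim
  omega

end CSSCode

/-! ### Short lattice vectors and the Hermite constant. -/

open MeasureTheory in
/-- Minkowski: a lattice of `ℝ^D` has a nonzero vector of norm `O(vol(L)^(1/D))`. -/
theorem exists_forall_zlattice_norm_le_mul_covolume_rpow {D : ℕ} (hD : 1 ≤ D) :
    ∃ R : ℝ, 0 < R ∧ ∀ (L : Submodule ℤ (EuclideanSpace ℝ (Fin D))) [DiscreteTopology L]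
      [IsZLattice ℝ L], ∃ x ∈ L, x ≠ 0 ∧ ‖x‖ ≤ R * ZLattice.covolume L ^ ((1 : ℝ) / D) := by
  have : Nonempty (Fin D) := ⟨⟨0, hD⟩⟩
  set μ : Measure (EuclideanSpace ℝ (Fin D)) := volume
  set v : ℝ := μ.real (Metric.ball 0 1) with hv
  have hvpos : 0 < v :=
    ENNReal.toReal_pos (Metric.measure_ball_pos μ 0 one_pos).ne' measure_ball_lt_top.ne
  have hball : μ (Metric.ball 0 1) = ENNReal.ofReal v :=
    (ENNReal.ofReal_toReal measure_ball_lt_top.ne).symm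
  -- This factor avoids a `D`-th root of the ball volume `v`: `(1 + 1/v)^D * v ≥ v + 1 > 1`.
  refine ⟨2 * (1 + 1 / v), by positivity, fun L _ _ => ?_⟩
  have := ZLattice.module_finite ℝ L
  have := ZLattice.module_free ℝ L
  let b := Module.Free.chooseBasis ℤ L
  have fund := ZLattice.isAddFundamentalDomain b μ
  have hcov := ZLattice.covolume_eq_measure_fundamentalDomain L μ fund
  set c := ZLattice.covolume L μ with hc
  have hcpos : 0 < c := ZLattice.covolume_pos L μ
  set F := ZSpan.fundamentalDomain (b.ofZLatticeBasis ℝ)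
  have hFtop : μ F ≠ ⊤ := by
    intro h
    rw [Measure.real, h, ENNReal.toReal_top] at hcov
    exact hcpos.ne' hcov
  have hF : μ F = ENNReal.ofReal c := by
    rw [hcov, Measure.real, ENNReal.ofReal_toReal hFtop]
  set r := 2 * (1 + 1 / v) * c ^ ((1 : ℝ) / D) with hr
  have hrpos : 0 < r := by positivity
  have hD0 : (D : ℝ) ≠ 0 := by positivity
  have hrD : r ^ D = 2 ^ D * (1 + 1 / v) ^ D * c := by
    rw [hr, mul_pow, mul_pow, ← Real.rpow_natCast (c ^ _), ← Real.rpow_mul hcpos.le,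
      one_div_mul_cancel hD0, Real.rpow_one]
  have hlt : c * 2 ^ D < r ^ D * v := by
    have h1 : (1 + 1 / v) ≤ (1 + 1 / v) ^ D :=
      le_self_pow₀ (by simp [hvpos.le]) (by omega)
    have h2 : (1 + 1 / v) * v = v + 1 := by field_simp
    have h3 : 1 < (1 + 1 / v) ^ D * v := by nlinarith
    rw [hrD]
    nlinarith [mul_lt_mul_of_pos_left h3 (show 0 < 2 ^ D * c by positivity)]
  have : Countable L.toAddSubgroup := inferInstanceAs (Countable L)
  have hmink := exists_ne_zero_mem_lattice_of_measure_mul_two_pow_lt_measure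
    (L := L.toAddSubgroup) (s := Metric.ball 0 r) fund
    (fun x hx => by simpa using hx) (convex_ball 0 r) (by
      rw [finrank_euclideanSpace_fin, Measure.addHaar_ball_of_pos μ _ hrpos,
        finrank_euclideanSpace_fin, hF, hball, ← ENNReal.ofReal_mul (by positivity),
        show (2 : ENNReal) = ENNReal.ofReal 2 by simp,
        ← ENNReal.ofReal_pow (by norm_num), ← ENNReal.ofReal_mul (by positivity)]
      exact (ENNReal.ofReal_lt_ofReal_iff (by positivity)).2 hlt)
  obtain ⟨x, hx0, hx⟩ := hmink
  refine ⟨x, x.2, fun h => hx0 (Subtype.ext h), ?_⟩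
  rw [mem_ball_zero_iff] at hx
  exact hx.le

/-- A lattice of positive dimension has a shortest nonzero vector. -/
theorem ZLattice.exists_isLeast_norm {D : ℕ} (hD : 1 ≤ D)
    (L : Submodule ℤ (EuclideanSpace ℝ (Fin D))) [DiscreteTopology L] [IsZLattice ℝ L] :
    ∃ x ∈ L, x ≠ 0 ∧ ∀ y ∈ L, y ≠ 0 → ‖x‖ ≤ ‖y‖ := by
  obtain ⟨R, -, hR⟩ := exists_forall_zlattice_norm_le_mul_covolume_rpow hD
  obtain ⟨x₀, hx₀, hx₀0, -⟩ := hR L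
  have := ZLattice.module_finite ℝ L
  have := ZLattice.module_free ℝ L
  let b := Module.Free.chooseBasis ℤ L
  have hfin : (Metric.closedBall (0 : EuclideanSpace ℝ (Fin D)) ‖x₀‖ ∩ L).Finite := by
    have := ZSpan.setFinite_inter (b.ofZLatticeBasis ℝ)
      (Metric.isBounded_closedBall (x := (0 : EuclideanSpace ℝ (Fin D))) (r := ‖x₀‖))
    rwa [b.ofZLatticeBasis_span ℝ] at this
  obtain ⟨x, ⟨⟨-, hxL⟩, hx0⟩, hmin⟩ := Set.exists_min_image
    ((Metric.closedBall 0 ‖x₀‖ ∩ L) \ {0}) (fun x => ‖x‖) hfin.sdiff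
    ⟨x₀, ⟨by simp, hx₀⟩, hx₀0⟩
  refine ⟨x, hxL, hx0, fun y hy hy0 => ?_⟩
  rcases le_total ‖y‖ ‖x₀‖ with h | h
  · exact hmin y ⟨⟨by simpa using h, hy⟩, hy0⟩
  · exact (hmin x₀ ⟨⟨by simp, hx₀⟩, hx₀0⟩).trans h

theorem hermiteInvariant_eq_of_forall_norm_le {D : ℕ}
    (L : Submodule ℤ (EuclideanSpace ℝ (Fin D))) [DiscreteTopology L] [IsZLattice ℝ L]
    {x : EuclideanSpace ℝ (Fin D)} (hx : x ∈ L) (hx0 : x ≠ 0)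
    (hmin : ∀ y ∈ L, y ≠ 0 → ‖x‖ ≤ ‖y‖) :
    hermiteInvariant L = (‖x‖ / ZLattice.covolume L ^ ((1 : ℝ) / D)) ^ 2 := by
  refine IsLeast.csInf_eq ⟨⟨x, hx, hx0, rfl⟩, ?_⟩
  rintro _ ⟨y, hy, hy0, rfl⟩
  have := ZLattice.covolume_pos L
  have := hmin y hy hy0
  gcongr

/-- Without this bound, supplied by Minkowski, the real `sSup` defining `hermiteConstant` could be a
junk value. -/
theorem bddAbove_hermiteInvariant {D : ℕ} (hD : 1 ≤ D) :
    BddAbove {t : ℝ | ∃ (L : Submodule ℤ (EuclideanSpace ℝ (Fin D))) (_ : DiscreteTopology L),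
      IsZLattice ℝ L ∧ t = hermiteInvariant L} := by
  obtain ⟨R, hRpos, hR⟩ := exists_forall_zlattice_norm_le_mul_covolume_rpow hD
  refine ⟨R ^ 2, ?_⟩
  rintro _ ⟨L, _, _, rfl⟩
  obtain ⟨x, hx, hx0, hmin⟩ := ZLattice.exists_isLeast_norm hD L
  rw [hermiteInvariant_eq_of_forall_norm_le L hx hx0 hmin]
  obtain ⟨y, hy, hy0, hyR⟩ := hR L
  have hc := ZLattice.covolume_pos L
  have : ‖x‖ / ZLattice.covolume L ^ ((1 : ℝ) / D) ≤ R := by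
    rw [div_le_iff₀ (by positivity)]
    exact (hmin y hy hy0).trans hyR
  gcongr

theorem ZLattice.exists_norm_le_sqrt_hermiteConstant_mul {D : ℕ} (hD : 1 ≤ D)
    (L : Submodule ℤ (EuclideanSpace ℝ (Fin D))) [DiscreteTopology L] [IsZLattice ℝ L] :
    ∃ x ∈ L, x ≠ 0 ∧ ‖x‖ ≤ √(hermiteConstant D) * ZLattice.covolume L ^ ((1 : ℝ) / D) := by
  obtain ⟨x, hx, hx0, hmin⟩ := ZLattice.exists_isLeast_norm hD L
  refine ⟨x, hx, hx0, ?_⟩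
  have hc := ZLattice.covolume_pos L
  rw [← div_le_iff₀ (by positivity)]
  refine Real.le_sqrt_of_sq_le ?_
  rw [← hermiteInvariant_eq_of_forall_norm_le L hx hx0 hmin]
  exact le_csSup (bddAbove_hermiteInvariant hD) ⟨L, ‹_›, ‹_›, rfl⟩

/-- The lattice `ℤ^D` of vectors with integral coordinates. -/
noncomputable def integerLattice (D : ℕ) : Submodule ℤ (EuclideanSpace ℝ (Fin D)) :=
  Submodule.span ℤ (Set.range (EuclideanSpace.basisFun (Fin D) ℝ).toBasis)

instance (D : ℕ) : DiscreteTopology (integerLattice D) := by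
  unfold integerLattice; infer_instance

instance (D : ℕ) : IsZLattice ℝ (integerLattice D) := by
  unfold integerLattice; infer_instance

theorem mem_integerLattice {D : ℕ} {x : EuclideanSpace ℝ (Fin D)} :
    x ∈ integerLattice D ↔ ∀ i, ∃ k : ℤ, x i = k := by
  rw [integerLattice, Module.Basis.mem_span_iff_repr_mem]
  simp [eq_comm]

theorem covolume_integerLattice (D : ℕ) : ZLattice.covolume (integerLattice D) = 1 := by
  rw [ZLattice.covolume_eq_measure_fundamentalDomain (integerLattice D) _
    (ZSpan.isAddFundamentalDomain (EuclideanSpace.basisFun (Fin D) ℝ).toBasis MeasureTheory.volume),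
    MeasureTheory.measureReal_congr (ZSpan.fundamentalDomain_ae_parallelepiped _ _),
    MeasureTheory.Measure.real, OrthonormalBasis.coe_toBasis,
    OrthonormalBasis.volume_parallelepiped, ENNReal.toReal_one]

/-- Test on `ℤ^D`, which has covolume `1` and no nonzero vector shorter than `1`. -/
theorem one_le_hermiteConstant {D : ℕ} (hD : 1 ≤ D) : 1 ≤ hermiteConstant D := by
  obtain ⟨x, hx, hx0, hle⟩ := ZLattice.exists_norm_le_sqrt_hermiteConstant_mul hD (integerLattice D)
  rw [covolume_integerLattice, Real.one_rpow, mul_one] at hle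
  have h1 : 1 ≤ ‖x‖ := by
    obtain ⟨i, hi⟩ : ∃ i, x i ≠ 0 := by
      by_contra! h
      exact hx0 (by ext i; exact h i)
    obtain ⟨k, hk⟩ := mem_integerLattice.1 hx i
    refine le_trans ?_ (PiLp.norm_apply_le x i)
    rw [hk] at hi ⊢
    rw [Real.norm_eq_abs]
    exact_mod_cast Int.one_le_abs (Int.cast_ne_zero.1 hi)
  exact Real.one_le_sqrt.1 (h1.trans hle)

/-! ### The lattice of characters of a finite abelian group. -/

theorem Circle.exp_two_pi_mul_eq_iff {x y : ℝ} :
    Circle.exp (2 * Real.pi * x) = Circle.exp (2 * Real.pi * y) ↔ ∃ k : ℤ, x = y + k := by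
  rw [Circle.exp_eq_exp]
  refine exists_congr fun k => ?_
  have := Real.pi_pos
  constructor
  · intro h
    have : 2 * Real.pi * x = 2 * Real.pi * (y + k) := by rw [h]; ring
    exact mul_left_cancel₀ (by positivity) this
  · rintro rfl
    ring

theorem Circle.exp_two_pi_mul_eq_one_iff {x : ℝ} :
    Circle.exp (2 * Real.pi * x) = 1 ↔ ∃ k : ℤ, x = k := by
  have := Circle.exp_two_pi_mul_eq_iff (x := x) (y := 0)
  simpa using this

theorem Circle.exists_exp_two_pi_mul_eq (z : Circle) :
    ∃ x : ℝ, 0 ≤ x ∧ x < 1 ∧ Circle.exp (2 * Real.pi * x) = z := by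
  obtain ⟨y, rfl⟩ := Circle.exp_surjective z
  have := Real.pi_pos
  refine ⟨Int.fract (y / (2 * Real.pi)), Int.fract_nonneg _, Int.fract_lt_one _, ?_⟩
  have h : Circle.exp y = Circle.exp (2 * Real.pi * (y / (2 * Real.pi))) := by
    congr 1
    field_simp
  rw [h, Circle.exp_two_pi_mul_eq_iff]
  exact ⟨-⌊y / (2 * Real.pi)⌋, by rw [Int.fract]; push_cast; ring⟩

/-- The logarithms of the tuples of values at `g` of the characters of `H`. -/
noncomputable def characterLattice {H : Type*} [CommGroup H] {D : ℕ} (g : Fin D → H) :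
    Submodule ℤ (EuclideanSpace ℝ (Fin D)) :=
  AddSubgroup.toIntSubmodule
    { carrier := {u | ∃ χ : H →* Circle, ∀ i, χ (g i) = Circle.exp (2 * Real.pi * u i)}
      add_mem' := by
        rintro u v ⟨χ, hχ⟩ ⟨ψ, hψ⟩
        exact ⟨χ * ψ, fun i => by simp [hχ, hψ, mul_add, Circle.exp_add]⟩
      zero_mem' := ⟨1, by simp⟩
      neg_mem' := by
        rintro u ⟨χ, hχ⟩
        exact ⟨χ⁻¹, fun i => by simp [hχ, Circle.exp_neg]⟩ }

section

variable {H : Type*} [CommGroup H] {D : ℕ} (g : Fin D → H)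

theorem integerLattice_le_characterLattice : integerLattice D ≤ characterLattice g := by
  intro u hu
  refine ⟨1, fun i => ?_⟩
  rw [eq_comm, MonoidHom.one_apply, Circle.exp_two_pi_mul_eq_one_iff]
  exact mem_integerLattice.1 hu i

variable [Finite H]

/-- Character values are `|H|`-th roots of unity, so coordinates lie in `(1/|H|)ℤ`. -/
instance : DiscreteTopology (characterLattice g) := by
  refine discreteTopology_of_isOpen_singleton_zero ?_
  rw [Metric.isOpen_singleton_iff]
  have hN : (0 : ℝ) < Nat.card H := by exact_mod_cast Nat.card_pos
  refine ⟨1 / Nat.card H, by positivity, fun u hu => ?_⟩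
  obtain ⟨χ, hχ⟩ := u.2
  ext i
  have hpow : Circle.exp (2 * Real.pi * (Nat.card H * u.1 i)) = 1 := by
    rw [show 2 * Real.pi * (Nat.card H * u.1 i) = (Nat.card H : ℕ) • (2 * Real.pi * u.1 i) by
      rw [nsmul_eq_mul]; ring, Circle.exp_nsmul, ← hχ, ← map_pow, pow_card_eq_one', map_one]
  obtain ⟨k, hk⟩ := Circle.exp_two_pi_mul_eq_one_iff.1 hpow
  rw [dist_zero_right, lt_div_iff₀ hN] at hu
  have h1 : |u.1 i| ≤ ‖u‖ := PiLp.norm_apply_le u.1 i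
  have h2 : |(k : ℝ)| < 1 := by
    rw [← hk, abs_mul, abs_of_pos hN]
    nlinarith
  have h3 : k = 0 := Int.abs_lt_one_iff.1 (by exact_mod_cast h2)
  rw [h3, Int.cast_zero] at hk
  simpa [hN.ne'] using hk

instance : IsZLattice ℝ (characterLattice g) where
  span_top := by
    refine top_le_iff.1 ?_
    rw [← IsZLattice.span_top (K := ℝ) (L := integerLattice D)]
    exact Submodule.span_mono (integerLattice_le_characterLattice g)

theorem finite_and_natCard_eq_natCard_monoidHom_circle (H : Type*) [CommGroup H] [Finite H] :
    Finite (H →* Circle) ∧ Nat.card H = Nat.card (H →* Circle) := by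
  have := Fintype.ofFinite H
  let e : (H →* Circle) ≃ AddChar (Additive H) ℂ :=
    (show (H →* Circle) ≃ AddChar (Additive H) Circle from
      { toFun := fun χ =>
          { toFun := fun h => χ h.toMul
            map_zero_eq_one' := map_one χ
            map_add_eq_mul' := fun x y => map_mul χ _ _ }
        invFun := fun ψ =>
          { toFun := fun h => ψ (Additive.ofMul h)
            map_one' := ψ.map_zero_eq_one
            map_mul' := fun x y => ψ.map_add_eq_mul _ _ }
        left_inv := fun _ => rfl
        right_inv := fun _ => rfl }).trans AddChar.circleEquivComplex.toEquiv
  have : Finite (H →* Circle) := Finite.of_equiv _ e.symm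
  refine ⟨this, ?_⟩
  rw [Nat.card_congr e, Nat.card_eq_fintype_card (α := AddChar (Additive H) ℂ), AddChar.card_eq,
    Nat.card_eq_fintype_card]
  exact Fintype.card_congr Additive.ofMul

/-- A character is determined by its values on generators, so distinct characters have logarithms in
distinct classes modulo `ℤ^D`, and there are `|H|` characters. -/
theorem covolume_characterLattice_le (hg : Subgroup.closure (Set.range g) = ⊤) :
    ZLattice.covolume (characterLattice g) ≤ 1 / Nat.card H := by
  have hidx := ZLattice.covolume_div_covolume_eq_relIndex' (integerLattice D) (characterLattice g)
    (integerLattice_le_characterLattice g)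
  have hcpos := ZLattice.covolume_pos (characterLattice g)
  rw [covolume_integerLattice] at hidx
  have hN : (0 : ℝ) < Nat.card H := by exact_mod_cast Nat.card_pos
  -- An infinite index would be recorded as `0`; excluding it makes the quotient finite, as the
  -- counting by injection requires.
  have hne : (integerLattice D).toAddSubgroup.relIndex (characterLattice g).toAddSubgroup ≠ 0 := by
    intro h
    rw [h, Nat.cast_zero] at hidx
    exact (one_div_pos.2 hcpos).ne' hidx
  suffices h : Nat.card H ≤
      (integerLattice D).toAddSubgroup.relIndex (characterLattice g).toAddSubgroup by
    have h' : (Nat.card H : ℝ) ≤ 1 / ZLattice.covolume (characterLattice g) := by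
      rw [hidx]
      exact_mod_cast h
    rw [le_div_iff₀ hcpos] at h'
    rw [le_div_iff₀ hN, mul_comm]
    exact h'
  rw [(finite_and_natCard_eq_natCard_monoidHom_circle H).2]
  have : Finite ((characterLattice g).toAddSubgroup ⧸
      (integerLattice D).toAddSubgroup.addSubgroupOf (characterLattice g).toAddSubgroup) :=
    (Nat.card_ne_zero.1 hne).2
  choose l _ _ hl using fun (χ : H →* Circle) (i : Fin D) =>
    Circle.exists_exp_two_pi_mul_eq (χ (g i))
  refine Nat.card_le_card_of_injective (fun χ : H →* Circle => QuotientAddGroup.mk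
    (s := (integerLattice D).toAddSubgroup.addSubgroupOf (characterLattice g).toAddSubgroup)
    (⟨WithLp.toLp 2 (l χ), χ, fun i => (hl χ i).symm⟩ :
      (characterLattice g).toAddSubgroup)) fun χ ψ h => ?_
  rw [QuotientAddGroup.eq, AddSubgroup.mem_addSubgroupOf] at h
  refine MonoidHom.eq_of_eqOn_dense hg ?_
  rintro _ ⟨i, rfl⟩
  obtain ⟨k, hk⟩ := mem_integerLattice.1 h i
  rw [← hl, ← hl, eq_comm, Circle.exp_two_pi_mul_eq_iff]
  have hk' : -l χ i + l ψ i = k := hk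
  exact ⟨k, by linarith⟩

/-- A finite abelian group generated by `D` elements has a character which is nontrivial, but
close to `1`, at these elements. -/
theorem exists_monoidHom_circle_near_one (hD : 1 ≤ D)
    (hg : Subgroup.closure (Set.range g) = ⊤) :
    ∃ (χ : H →* Circle) (u : Fin D → ℝ), (∃ i, u i ≠ 0) ∧
      (∀ i, χ (g i) = Circle.exp (2 * Real.pi * u i)) ∧
      ∀ i, |u i| ≤ √(hermiteConstant D) * (1 / (Nat.card H : ℝ)) ^ ((1 : ℝ) / D) := by
  obtain ⟨u, ⟨χ, hχ⟩, hu0, hu⟩ :=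
    ZLattice.exists_norm_le_sqrt_hermiteConstant_mul hD (characterLattice g)
  refine ⟨χ, u, ?_, hχ, fun i => (PiLp.norm_apply_le u i).trans (hu.trans ?_)⟩
  · by_contra! h
    exact hu0 (by ext i; exact h i)
  · have := (ZLattice.covolume_pos (characterLattice g)).le
    have := covolume_characterLattice_le g hg
    gcongr

end

/-! ### Cutting the group into strips along a character. -/

/-- With `m` the order of the image, the angles lie in `(1/m)ℤ`; a half-open interval of length `l`
contains at most `l * m + 1` of these, and each value of `χ` is taken `|H| / m` times. -/
theorem natCard_strip_mul_le {H : Type*} [CommGroup H] [Finite H] (χ : H →* Circle) (θ : H → ℝ)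
    (hθ : ∀ h, Circle.exp (2 * Real.pi * θ h) = χ h) (x l : ℝ) (hl : 0 ≤ l) :
    (Nat.card {h // x ≤ θ h ∧ θ h < x + l} : ℝ) * Nat.card χ.range ≤
      (l * Nat.card χ.range + 1) * Nat.card H := by
  classical
  have := Fintype.ofFinite H
  set m := Nat.card χ.range with hm
  have hmpos : (0 : ℝ) < m := by
    rw [hm]
    exact_mod_cast Nat.card_pos
  have hint : ∀ h, ∃ k : ℤ, m * θ h = k := fun h => by
    rw [← Circle.exp_two_pi_mul_eq_one_iff,
      show 2 * Real.pi * (m * θ h) = m • (2 * Real.pi * θ h) by rw [nsmul_eq_mul]; ring,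
      Circle.exp_nsmul, hθ]
    exact congrArg Subtype.val (pow_card_eq_one' (x := (⟨χ h, h, rfl⟩ : χ.range)))
  choose k hk using hint
  set S : Finset H := Finset.univ.filter fun h => x ≤ θ h ∧ θ h < x + l
  have hS : Nat.card {h // x ≤ θ h ∧ θ h < x + l} = S.card := by
    rw [Nat.card_eq_fintype_card, Fintype.card_subtype]
  have hfib : ∀ j ∈ S.image k, (S.filter fun h => k h = j).card ≤ Nat.card χ.ker := by
    intro j hj
    obtain ⟨h₀, -, rfl⟩ := Finset.mem_image.1 hj
    change _ ≤ Nat.card (χ.ker : Set H)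
    rw [Nat.card_eq_card_toFinset]
    refine Finset.card_le_card_of_injOn (fun h => h * h₀⁻¹) (fun h hh => ?_)
      (fun a _ b _ hab => mul_right_cancel hab)
    have h1 : k h = k h₀ := (Finset.mem_filter.1 hh).2
    have h2 : θ h = θ h₀ := by
      refine mul_left_cancel₀ hmpos.ne' ?_
      rw [hk, hk, h1]
    rw [Finset.mem_coe, Set.mem_toFinset, SetLike.mem_coe, MonoidHom.mem_ker, map_mul, map_inv,
      ← hθ, ← hθ, h2, mul_inv_cancel]
  have himg : ((S.image k).card : ℝ) ≤ l * m + 1 := by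
    have hsub : S.image k ⊆ Finset.Ico ⌈m * x⌉ ⌈m * (x + l)⌉ := by
      intro j hj
      obtain ⟨h, hh, rfl⟩ := Finset.mem_image.1 hj
      obtain ⟨h1, h2⟩ := (Finset.mem_filter.1 hh).2
      rw [Finset.mem_Ico, Int.ceil_le, Int.lt_ceil, ← hk]
      exact ⟨by gcongr, by gcongr⟩
    have hle : ⌈m * x⌉ ≤ ⌈m * (x + l)⌉ := Int.ceil_le_ceil (by nlinarith)
    calc ((S.image k).card : ℝ) ≤ ((Finset.Ico ⌈m * x⌉ ⌈m * (x + l)⌉).card : ℝ) := by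
          exact_mod_cast Finset.card_le_card hsub
      _ = ((⌈m * (x + l)⌉ - ⌈m * x⌉ : ℤ) : ℝ) := by
          rw [Int.card_Ico]
          exact_mod_cast Int.toNat_of_nonneg (sub_nonneg.2 hle)
      _ ≤ l * m + 1 := by
          push_cast
          linarith [Int.ceil_lt_add_one (m * (x + l)), Int.le_ceil (m * x)]
  have hcard : (S.card : ℝ) ≤ Nat.card χ.ker * (S.image k).card := by
    exact_mod_cast Finset.card_le_mul_card_image S _ hfib
  have hH : (Nat.card χ.ker : ℝ) * m = Nat.card H := by
    rw [hm, ← Subgroup.index_ker]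
    exact_mod_cast Subgroup.card_mul_index χ.ker
  rw [hS, ← hH]
  calc (S.card : ℝ) * m ≤ Nat.card χ.ker * (S.image k).card * m := by gcongr
    _ ≤ Nat.card χ.ker * (l * m + 1) * m := by gcongr
    _ = _ := by ring

/-- A nonzero multiple of `1/m` is at least `1/m` in absolute value. This absorbs the `+ 1` in the
strip count. -/
theorem one_le_natCard_range_mul {H : Type*} [CommGroup H] [Finite H] (χ : H →* Circle) {h : H}
    {u ε : ℝ} (hχ : χ h = Circle.exp (2 * Real.pi * u)) (hu : u ≠ 0) (huε : |u| ≤ ε) :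
    1 ≤ Nat.card χ.range * ε := by
  have : Finite χ.range := Finite.of_surjective _ χ.rangeRestrict_surjective
  have hmpos : (0 : ℝ) < Nat.card χ.range := by exact_mod_cast Nat.card_pos
  have h1 : Circle.exp (2 * Real.pi * (Nat.card χ.range * u)) = 1 := by
    rw [show 2 * Real.pi * (Nat.card χ.range * u) = Nat.card χ.range • (2 * Real.pi * u) by
      rw [nsmul_eq_mul]; ring, Circle.exp_nsmul, ← hχ]
    exact congrArg Subtype.val (pow_card_eq_one' (x := (⟨χ h, h, rfl⟩ : χ.range)))
  obtain ⟨k, hk⟩ := Circle.exp_two_pi_mul_eq_one_iff.1 h1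
  have hk0 : k ≠ 0 := by
    rintro rfl
    rw [Int.cast_zero] at hk
    exact mul_ne_zero hmpos.ne' hu hk
  calc (1 : ℝ) ≤ |(k : ℝ)| := by exact_mod_cast Int.one_le_abs hk0
    _ = Nat.card χ.range * |u| := by rw [← hk, abs_mul, abs_of_pos hmpos]
    _ ≤ _ := by gcongr

/-- Cut the circle into `2 * s` equal arcs: two points at distance at most the length of an arc
which lie in arcs of the same parity lie in the same arc. -/
theorem floor_eq_floor_of_even_iff_even {s : ℕ} {θ θ' u u' ε : ℝ} (hs : 4 * ε * s ≤ 1)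
    (hθ0 : 0 ≤ θ) (hθ1 : θ < 1) (hθ0' : 0 ≤ θ') (hθ1' : θ' < 1) (hu : |u| ≤ ε) (hu' : |u'| ≤ ε)
    (h : Circle.exp (2 * Real.pi * (θ + u)) = Circle.exp (2 * Real.pi * (θ' + u')))
    (heven : Even ⌊2 * s * θ⌋ ↔ Even ⌊2 * s * θ'⌋) : ⌊2 * s * θ⌋ = ⌊2 * s * θ'⌋ := by
  obtain ⟨k, hk⟩ := Circle.exp_two_pi_mul_eq_iff.1 h
  have hs0 : (0 : ℝ) ≤ s := Nat.cast_nonneg s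
  rw [abs_le] at hu hu'
  set j := ⌊2 * s * θ⌋ with hj
  set j' := ⌊2 * s * θ'⌋ with hj'
  have a1 : (j : ℝ) ≤ 2 * s * θ := Int.floor_le _
  have a2 : 2 * s * θ < j + 1 := Int.lt_floor_add_one _
  have b1 : (j' : ℝ) ≤ 2 * s * θ' := Int.floor_le _
  have b2 : 2 * s * θ' < j' + 1 := Int.lt_floor_add_one _
  have e1 : 2 * s * θ - 2 * s * θ' - 2 * s * k = 2 * s * (u' - u) := by
    rw [show θ = θ' + u' + k - u by linarith]
    ring
  have e2 : 2 * s * (u' - u) ≤ 1 := by nlinarith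
  have e3 : -1 ≤ 2 * s * (u' - u) := by nlinarith
  have f1 : j - j' - 2 * s * k < 2 := by
    have : (j : ℝ) - j' - 2 * s * k < 2 := by linarith
    exact_mod_cast this
  have f2 : -2 < j - j' - 2 * s * k := by
    have : (-2 : ℝ) < j - j' - 2 * s * k := by linarith
    exact_mod_cast this
  have hpar : Even (j - j' - 2 * s * k) := by
    rw [Int.even_sub, Int.even_sub]
    have : Even (2 * (s : ℤ) * k) := by simp [mul_assoc]
    tauto
  obtain ⟨r, hr⟩ := hpar
  -- An even integer strictly between `-2` and `2` vanishes. Since both angles lie in `[0, 1)`, the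
  -- winding number `k` is then `0` too.
  have hjk : j - j' = 2 * s * k := by omega
  have hs1 : (0 : ℝ) < 2 * s ∨ s = 0 := by
    rcases Nat.eq_zero_or_pos s with h | h
    · exact Or.inr h
    · exact Or.inl (by positivity)
  rcases hs1 with hs1 | hs1
  · have g1 : (j : ℝ) - j' = 2 * s * k := by exact_mod_cast hjk
    have g0 : (0 : ℝ) ≤ j := by exact_mod_cast Int.floor_nonneg.2 (by positivity)
    have g0' : (0 : ℝ) ≤ j' := by exact_mod_cast Int.floor_nonneg.2 (by positivity)
    have c1 : 2 * s * θ < 2 * s := by nlinarith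
    have c2 : 2 * s * θ' < 2 * s := by nlinarith
    have hk1 : (k : ℝ) < 1 := by
      by_contra! hcon
      nlinarith
    have hk2 : (-1 : ℝ) < k := by
      by_contra! hcon
      nlinarith
    have hk0 : k = 0 := by
      have hk1' : k < 1 := by exact_mod_cast hk1
      have hk2' : -1 < k := by exact_mod_cast hk2
      omega
    rw [hk0, mul_zero] at hjk
    omega
  · subst hs1
    simp at hjk
    omega

/-- A finite abelian group generated by `D` elements can be divided into cells which are labelled
by integers: cells whose labels have the same parity are separated, in the Cayley graph, and the
cells have `O(ε |H|)` elements, with `ε = √γ_D |H|^(-1/D)`. -/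
theorem exists_separated_strips {H : Type*} [CommGroup H] [Finite H] {D : ℕ} (hD : 1 ≤ D)
    (g : Fin D → H) (hg : Subgroup.closure (Set.range g) = ⊤) {ε : ℝ}
    (hε : ε = √(hermiteConstant D) * (1 / (Nat.card H : ℝ)) ^ ((1 : ℝ) / D)) (hε8 : ε ≤ 1 / 8) :
    ∃ f : H → ℤ,
      (∀ x x' t t', t ∈ insert 1 (Set.range g) → t' ∈ insert 1 (Set.range g) → x * t = x' * t' →
        (Even (f x) ↔ Even (f x')) → f x = f x') ∧
      ∀ j, (Nat.card {x // f x = j} : ℝ) ≤ 5 * ε * Nat.card H := by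
  have hN : (0 : ℝ) < Nat.card H := by exact_mod_cast Nat.card_pos
  have hγ := one_le_hermiteConstant hD
  have hεpos : 0 < ε := by
    rw [hε]
    have : 0 < √(hermiteConstant D) := Real.sqrt_pos.2 (by linarith)
    positivity
  obtain ⟨χ, u, ⟨i₀, hi₀⟩, hχ, hu⟩ := exists_monoidHom_circle_near_one g hD hg
  rw [← hε] at hu
  choose θ hθ0 hθ1 hθ using fun h => Circle.exists_exp_two_pi_mul_eq (χ h)
  -- The largest `s` for which the arcs, of length `1 / (2 * s)`, are at least `2ε` long; as `ε ≤
  -- 1/8`, rounding down loses at most a factor `2`, so they are at most `4ε` long.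
  set s : ℕ := ⌊1 / (4 * ε)⌋₊ with hs
  have hs1 : 4 * ε * s ≤ 1 := by
    have : (s : ℝ) ≤ 1 / (4 * ε) := Nat.floor_le (by positivity)
    rwa [le_div_iff₀ (by positivity), mul_comm] at this
  have hs2 : 1 ≤ 8 * ε * s := by
    have h1 : 1 / (4 * ε) < s + 1 := Nat.lt_floor_add_one _
    rw [div_lt_iff₀ (by positivity)] at h1
    nlinarith
  have hspos : (0 : ℝ) < s := by
    by_contra! h
    nlinarith
  have hT : ∀ t ∈ insert 1 (Set.range g), ∃ v : ℝ, |v| ≤ ε ∧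
      χ t = Circle.exp (2 * Real.pi * v) := by
    rintro t (rfl | ⟨i, rfl⟩)
    · exact ⟨0, by simp [hεpos.le], by simp⟩
    · exact ⟨u i, hu i, hχ i⟩
  refine ⟨fun h => ⌊2 * s * θ h⌋, fun x x' t t' ht ht' hxt => ?_, fun j => ?_⟩
  · obtain ⟨v, hv, hvt⟩ := hT t ht
    obtain ⟨v', hv', hvt'⟩ := hT t' ht'
    refine floor_eq_floor_of_even_iff_even hs1 (hθ0 x) (hθ1 x) (hθ0 x') (hθ1 x') hv hv' ?_
    rw [mul_add, mul_add, Circle.exp_add, Circle.exp_add, hθ, hθ, ← hvt, ← hvt', ← map_mul,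
      ← map_mul, hxt]
  · have hcount := natCard_strip_mul_le χ θ hθ (j / (2 * s)) (1 / (2 * s)) (by positivity)
    have hm := one_le_natCard_range_mul χ (hχ i₀) hi₀ (hu i₀)
    have heq : {h // (j : ℝ) / (2 * s) ≤ θ h ∧ θ h < j / (2 * s) + 1 / (2 * s)} =
        {h // ⌊2 * s * θ h⌋ = j} := by
      congr 1
      ext h
      rw [Int.floor_eq_iff, ← add_div, div_le_iff₀ (by positivity), lt_div_iff₀ (by positivity),
        mul_comm (θ h)]
    rw [heq] at hcount
    set m : ℝ := (Nat.card χ.range : ℝ)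
    have hmpos : 0 < m := by
      by_contra! h
      nlinarith
    have hl : 1 / (2 * (s : ℝ)) ≤ 4 * ε := by
      rw [div_le_iff₀ (by positivity)]
      nlinarith
    -- The `5` is `4` from the arc length plus `1` from `1 ≤ m * ε`.
    have h1 : (1 / (2 * (s : ℝ)) * m + 1) * Nat.card H ≤ 5 * ε * Nat.card H * m := by
      have : 1 / (2 * (s : ℝ)) * m + 1 ≤ 5 * ε * m := by nlinarith
      nlinarith
    exact le_of_mul_le_mul_right (hcount.trans h1) hmpos

/-! ### Codes placed on a Cayley graph. -/

theorem natCard_le_of_injOn {Q G : Type*} [Finite G] (pos : Q → G) (p : Q → Prop) (r : G → Prop)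
    (hinj : Set.InjOn pos {q | p q}) (hr : ∀ q, p q → r (pos q)) :
    Nat.card {q // p q} ≤ Nat.card {x // r x} :=
  Nat.card_le_card_of_injective (fun q => ⟨pos q, hr q q.2⟩) fun a b hab =>
    Subtype.ext (hinj a.2 b.2 (Subtype.ext_iff.1 hab))

namespace CSSCode

/-- A code whose qubits are placed, two at each point, at the points of a finite abelian group, and
whose generators are close to a point in a Cayley graph of degree `2 * D`. -/
theorem minDistance_le_of_pos {R Q G : Type*} [Fintype R] [Fintype Q] [CommGroup G] [Finite G]
    (C : CSSCode R Q) (hdim : 0 < C.dimension) (pos : Q → G) (p : Q → Prop)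
    (hp : Set.InjOn pos {q | p q}) (hnp : Set.InjOn pos {q | ¬ p q})
    {D : ℕ} (hD : 1 ≤ D) (g : Fin D → G)
    (hX : ∀ i q q', C.HX i q ≠ 0 → C.HX i q' ≠ 0 → ∃ t ∈ insert 1 (Set.range g),
      ∃ t' ∈ insert 1 (Set.range g), pos q * t = pos q' * t')
    (hZ : ∀ i q q', C.HZ i q ≠ 0 → C.HZ i q' ≠ 0 → ∃ t ∈ insert 1 (Set.range g),
      ∃ t' ∈ insert 1 (Set.range g), pos q * t = pos q' * t') :
    ∃ d : ℕ, C.minDistance ≤ d ∧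
      (d : ℝ) ≤ 10 * √(hermiteConstant D) * (Nat.card G : ℝ) ^ (((D : ℝ) - 1) / D) := by
  set H := Subgroup.closure (Set.range g) with hH
  let g' : Fin D → H := fun i => ⟨g i, Subgroup.subset_closure ⟨i, rfl⟩⟩
  have hg' : Subgroup.closure (Set.range g') = ⊤ := by
    rw [← Subgroup.closure_closure_coe_preimage (k := Set.range g)]
    congr 1
    ext x
    simp [g', Subtype.ext_iff]
  have hT : ∀ t ∈ insert 1 (Set.range g), ∃ s ∈ insert 1 (Set.range g'), (s : G) = t := by
    rintro t (rfl | ⟨i, rfl⟩)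
    · exact ⟨1, Or.inl rfl, rfl⟩
    · exact ⟨g' i, Or.inr ⟨i, rfl⟩, rfl⟩
  have hTH : ∀ t ∈ insert 1 (Set.range g), t ∈ H := fun t ht => by
    obtain ⟨s, -, rfl⟩ := hT t ht
    exact s.2
  have hcoset : ∀ {x x' t t' : G}, t ∈ insert 1 (Set.range g) → t' ∈ insert 1 (Set.range g) →
      x * t = x' * t' → (x : G ⧸ H) = x' := by
    intro x x' t t' ht ht' h
    rw [← QuotientGroup.mk_mul_of_mem x (hTH t ht), h, QuotientGroup.mk_mul_of_mem x' (hTH t' ht')]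
  -- Checks never join distinct cosets of `H`, so each coset is identified with `H` through a
  -- representative and cut separately.
  let r : G → H := fun x => ⟨(x : G ⧸ H).out⁻¹ * x, by
    rw [← QuotientGroup.eq, QuotientGroup.out_eq']⟩
  have hr : ∀ x : G, x = (x : G ⧸ H).out * r x := fun x => by simp [r]
  have hrinj : ∀ x x' : G, (x : G ⧸ H) = x' → r x = r x' → x = x' := fun x x' h1 h2 => by
    rw [hr x, hr x', h1, h2]
  have hcell : ∀ (κ : G ⧸ H) (P : H → Prop),
      Nat.card {x : G // (x : G ⧸ H) = κ ∧ P (r x)} ≤ Nat.card {h // P h} := fun κ P =>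
    Nat.card_le_card_of_injective (fun x => ⟨r x, x.2.2⟩) fun a b hab =>
      Subtype.ext (hrinj a b (a.2.1.trans b.2.1.symm) (Subtype.ext_iff.1 hab))
  set N := Nat.card H with hNdef
  have hNpos : (0 : ℝ) < N := by exact_mod_cast Nat.card_pos
  set ε := √(hermiteConstant D) * (1 / (N : ℝ)) ^ ((1 : ℝ) / D) with hε
  have hD0 : (0 : ℝ) < D := by exact_mod_cast hD
  -- The bound for `H` increases with `|H|`, so a proper subgroup does no harm.
  have hεN : ε * N ≤ √(hermiteConstant D) * (Nat.card G : ℝ) ^ (((D : ℝ) - 1) / D) := by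
    have h1 : (1 / (N : ℝ)) ^ ((1 : ℝ) / D) * N = (N : ℝ) ^ (((D : ℝ) - 1) / D) := by
      rw [one_div, Real.inv_rpow hNpos.le, sub_div, div_self hD0.ne', Real.rpow_sub hNpos,
        Real.rpow_one]
      ring
    have h2 : N ≤ Nat.card G := Nat.card_le_card_of_injective _ H.subtype_injective
    have h3 : (0 : ℝ) ≤ ((D : ℝ) - 1) / D := by
      have : (1 : ℝ) ≤ D := by exact_mod_cast hD
      exact div_nonneg (by linarith) hD0.le
    rw [hε, mul_assoc, h1]
    gcongr
  have hεN0 : 0 ≤ ε * N := by positivity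
  suffices h : ∃ d : ℕ, C.minDistance ≤ d ∧ (d : ℝ) ≤ 10 * (ε * N) by
    obtain ⟨d, h1, h2⟩ := h
    exact ⟨d, h1, by linarith⟩
  -- For `ε > 1/8` whole cosets serve as cells: within `p`, or within its complement, a coset
  -- carries at most `N < 8 * ε * N` qubits.
  rcases lt_or_ge (1 / 8) ε with h8 | h8
  · refine ⟨N, ?_, by nlinarith⟩
    have hN : ∀ κ : G ⧸ H, Nat.card {x : G // (x : G ⧸ H) = κ} ≤ N := fun κ => by
      have := hcell κ fun _ => True
      simpa using this
    refine C.minDistance_le_of_cells hdim N p (fun q => (pos q : G ⧸ H)) ?_ ?_ ?_ ?_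
    · intro i q q' hq hq' _ _
      obtain ⟨t, ht, t', ht', h⟩ := hX i q q' hq hq'
      exact hcoset ht ht' h
    · intro i q q' hq hq' _ _
      obtain ⟨t, ht, t', ht', h⟩ := hZ i q q' hq hq'
      exact hcoset ht ht' h
    · exact fun κ => (natCard_le_of_injOn pos _ (fun x => (x : G ⧸ H) = κ)
        (hp.mono fun q hq => hq.1) fun q hq => hq.2).trans (hN κ)
    · exact fun κ => (natCard_le_of_injOn pos _ (fun x => (x : G ⧸ H) = κ)
        (hnp.mono fun q hq => hq.1) fun q hq => hq.2).trans (hN κ)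
  · obtain ⟨f, hf, hfcard⟩ := exists_separated_strips hD g' hg' hε h8
    have hsep : ∀ {x x' t t' : G}, t ∈ insert 1 (Set.range g) → t' ∈ insert 1 (Set.range g) →
        x * t = x' * t' → (Even (f (r x)) ↔ Even (f (r x'))) →
        ((x : G ⧸ H), f (r x)) = ((x' : G ⧸ H), f (r x')) := by
      intro x x' t t' ht ht' h heven
      have hco := hcoset ht ht' h
      refine Prod.ext hco ?_
      obtain ⟨s, hs, rfl⟩ := hT t ht
      obtain ⟨s', hs', rfl⟩ := hT t' ht'
      refine hf _ _ s s' hs hs' (Subtype.ext ?_) heven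
      simp only [r, Subgroup.coe_mul, mul_assoc, h, hco]
    have hcells : ∀ (k : (G ⧸ H) × ℤ) (e : Q → Prop),
        Nat.card {q // e q ∧ ((pos q : G ⧸ H), f (r (pos q))) = k} ≤ ⌊10 * (ε * N)⌋₊ := by
      intro k e
      refine Nat.le_floor ?_
      have hone : ∀ p' : Q → Prop, Set.InjOn pos {q | p' q} →
          (Nat.card {q // p' q ∧ ((pos q : G ⧸ H), f (r (pos q))) = k} : ℝ) ≤ 5 * (ε * N) := by
        intro p' hp'
        have h1 := natCard_le_of_injOn pos
          (fun q => p' q ∧ ((pos q : G ⧸ H), f (r (pos q))) = k)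
          (fun x => (x : G ⧸ H) = k.1 ∧ f (r x) = k.2) (hp'.mono fun q hq => hq.1)
          fun q hq => Prod.ext_iff.1 hq.2
        have h2 := h1.trans (hcell k.1 fun h => f h = k.2)
        have h3 := hfcard k.2
        rw [mul_assoc] at h3
        exact le_trans (by exact_mod_cast h2) h3
      have hsplit : Nat.card {q // e q ∧ ((pos q : G ⧸ H), f (r (pos q))) = k} ≤
          Nat.card {q // p q ∧ ((pos q : G ⧸ H), f (r (pos q))) = k} +
          Nat.card {q // ¬ p q ∧ ((pos q : G ⧸ H), f (r (pos q))) = k} := by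
        classical
        simp only [Nat.card_eq_fintype_card, Fintype.card_subtype]
        refine le_trans (Finset.card_le_card fun q hq => ?_) (Finset.card_union_le _ _)
        simp only [Finset.mem_filter, Finset.mem_univ, true_and, Finset.mem_union] at hq ⊢
        tauto
      have h1 := hone p hp
      have h2 := hone (fun q => ¬ p q) hnp
      have h3 : (Nat.card {q // e q ∧ ((pos q : G ⧸ H), f (r (pos q))) = k} : ℝ) ≤
          Nat.card {q // p q ∧ ((pos q : G ⧸ H), f (r (pos q))) = k} +
          Nat.card {q // ¬ p q ∧ ((pos q : G ⧸ H), f (r (pos q))) = k} := by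
        exact_mod_cast hsplit
      linarith
    refine ⟨⌊10 * (ε * N)⌋₊, ?_, Nat.floor_le (by positivity)⟩
    -- X operators are cleaned on even strips and Z operators on odd ones.
    refine C.minDistance_le_of_cells hdim _ (fun q => Even (f (r (pos q))))
      (fun q => ((pos q : G ⧸ H), f (r (pos q)))) ?_ ?_ (fun k => hcells k _) fun k => hcells k _
    · intro i q q' hq hq' h1 h2
      obtain ⟨t, ht, t', ht', h⟩ := hX i q q' hq hq'
      exact hsep ht ht' h (iff_of_true h1 h2)
    · intro i q q' hq hq' h1 h2
      obtain ⟨t, ht, t', ht', h⟩ := hZ i q q' hq hq'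
      exact hsep ht ht' h (iff_of_false h1 h2)

end CSSCode

/-! ### Two-block group algebra codes. -/

section

variable {G : Type*} [CommGroup G] [Fintype G] [DecidableEq G] (a b : G → ZMod 2)

theorem abelian2BGA_HX_inl (x y : G) : (abelian2BGA a b).HX x (Sum.inl y) = a (x * y⁻¹) :=
  groupAlgebraMatrix_apply a x y

theorem abelian2BGA_HX_inr (x y : G) : (abelian2BGA a b).HX x (Sum.inr y) = b (x * y⁻¹) :=
  groupAlgebraMatrix_apply b x y

theorem abelian2BGA_HZ_inl (x y : G) : (abelian2BGA a b).HZ x (Sum.inl y) = b (y * x⁻¹) :=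
  groupAlgebraMatrix_apply b y x

theorem abelian2BGA_HZ_inr (x y : G) : (abelian2BGA a b).HZ x (Sum.inr y) = a (y * x⁻¹) :=
  groupAlgebraMatrix_apply a y x

theorem hammingNorm_abelian2BGA_HX_row :
    hammingNorm ((abelian2BGA a b).HX.row 1) = hammingNorm a + hammingNorm b := by
  have h : ∀ c : G → ZMod 2, hammingNorm (fun y => c (1 * y⁻¹)) = hammingNorm c := fun c => by
    refine Finset.card_bij (fun y _ => y⁻¹) (fun y hy => by simpa using hy)
      (fun y _ z _ hyz => inv_injective hyz) fun y hy => ⟨y⁻¹, by simpa using hy, inv_inv y⟩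
  rw [← h a, ← h b]
  unfold hammingNorm
  simp only [Finset.card_filter]
  rw [Fintype.sum_sum_type]
  simp only [Matrix.row, abelian2BGA_HX_inl, abelian2BGA_HX_inr]

/-- If `a = 0` or `b = 0`, then the code has a logical operator of weight one. -/
theorem abelian2BGA_minDistance_le_one (hdim : 0 < (abelian2BGA a b).dimension)
    (h : a = 0 ∨ b = 0) : (abelian2BGA a b).minDistance ≤ (1 : ℕ) := by
  have hsub : ∀ (e : G ⊕ G → Prop) (k : G ⊕ G), Nat.card {q // e q ∧ id q = k} ≤ 1 := fun e k =>
    Finite.card_le_one_iff_subsingleton.2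
      ⟨fun x y => Subtype.ext (x.2.2.trans y.2.2.symm)⟩
  rcases h with rfl | rfl
  · refine CSSCode.minDistance_le_of_cells _ hdim 1 (fun q => q.isLeft) id ?_ ?_
      (hsub _) (hsub _)
    · rintro i (q | q) q' hq _ he _
      · simp [abelian2BGA_HX_inl] at hq
      · simp at he
    · rintro i (q | q) q' hq _ he _
      · simp at he
      · simp [abelian2BGA_HZ_inr] at hq
  · refine CSSCode.minDistance_le_of_cells _ hdim 1 (fun q => q.isRight) id ?_ ?_
      (hsub _) (hsub _)
    · rintro i (q | q) q' hq _ he _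
      · simp at he
      · simp [abelian2BGA_HX_inr] at hq
    · rintro i (q | q) q' hq _ he _
      · simp [abelian2BGA_HZ_inl] at hq
      · simp at he

/-- The list of elements of `T` is padded with `z` up to length `D`. -/
theorem exists_fin_family_mem_of_card_le {α : Type*} (z : α) (T : Finset α) {D : ℕ}
    (hT : T.card ≤ D) : ∃ g : Fin D → α, ∀ t ∈ T, t ∈ Set.range g := by
  refine ⟨fun i => T.toList.getD i z, fun t ht => ?_⟩
  obtain ⟨i, hi, rfl⟩ := List.mem_iff_getElem.1 (Finset.mem_toList.2 ht)
  exact ⟨⟨i, hi.trans_le ((Finset.length_toList T).trans_le hT)⟩, List.getD_eq_getElem _ _ hi⟩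

/-- Normalizing each support by one of its own elements saves one generator per block; this is where
`w - 2` comes from. -/
theorem abelian2BGA_minDistance_le (hdim : 0 < (abelian2BGA a b).dimension) (ha : a ≠ 0)
    (hb : b ≠ 0) {D : ℕ} (hD : 1 ≤ D) (hw : hammingNorm a + hammingNorm b ≤ D + 2) :
    ∃ d : ℕ, (abelian2BGA a b).minDistance ≤ d ∧
      (d : ℝ) ≤ 10 * √(hermiteConstant D) * (Nat.card G : ℝ) ^ (((D : ℝ) - 1) / D) := by
  obtain ⟨x₀, hx₀⟩ := Function.ne_iff.1 ha
  obtain ⟨y₀, hy₀⟩ := Function.ne_iff.1 hb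
  let S : (G → ZMod 2) → Finset G := fun c => Finset.univ.filter fun x => c x ≠ 0
  have hS : ∀ (c : G → ZMod 2) (z : G), c z ≠ 0 →
      (((S c).erase z).image (· * z⁻¹)).card + 1 ≤ hammingNorm c := fun c z hz => by
    have hz : z ∈ S c := by simpa [S] using hz
    have := Finset.card_erase_add_one hz
    exact (Nat.add_le_add_right Finset.card_image_le 1).trans this.le
  obtain ⟨g, hg⟩ := exists_fin_family_mem_of_card_le (1 : G) (D := D)
    (((S a).erase x₀).image (· * x₀⁻¹) ∪ ((S b).erase y₀).image (· * y₀⁻¹)) (by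
      have h1 := hS a x₀ hx₀
      have h2 := hS b y₀ hy₀
      exact (Finset.card_union_le _ _).trans (by omega))
  have hga : ∀ x, a x ≠ 0 → x * x₀⁻¹ ∈ insert 1 (Set.range g) := fun x hx => by
    by_cases h : x = x₀
    · exact Or.inl (by rw [h, mul_inv_cancel])
    · exact Or.inr (hg _ (Finset.mem_union_left _ (Finset.mem_image_of_mem _ (by simp [S, h, hx]))))
  have hgb : ∀ x, b x ≠ 0 → x * y₀⁻¹ ∈ insert 1 (Set.range g) := fun x hx => by
    by_cases h : x = y₀
    · exact Or.inl (by rw [h, mul_inv_cancel])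
    · exact Or.inr
        (hg _ (Finset.mem_union_right _ (Finset.mem_image_of_mem _ (by simp [S, h, hx]))))
  -- The shifts undo the normalization: X check `i` becomes an inverse unit ball at `i`, and Z check
  -- `i` a unit ball at `i * x₀ * y₀`.
  let pos : G ⊕ G → G := Sum.elim (· * x₀) (· * y₀)
  have hXpos : ∀ i q, (abelian2BGA a b).HX i q ≠ 0 →
      ∃ t ∈ insert 1 (Set.range g), pos q * t = i := by
    rintro i (q | q) hq
    · rw [abelian2BGA_HX_inl] at hq
      refine ⟨_, hga _ hq, ?_⟩
      simp only [pos, Sum.elim_inl]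
      simp [mul_comm, mul_assoc, mul_left_comm]
    · rw [abelian2BGA_HX_inr] at hq
      refine ⟨_, hgb _ hq, ?_⟩
      simp only [pos, Sum.elim_inr]
      simp [mul_comm, mul_assoc, mul_left_comm]
  have hZpos : ∀ i q, (abelian2BGA a b).HZ i q ≠ 0 →
      ∃ t ∈ insert 1 (Set.range g), pos q = i * x₀ * y₀ * t := by
    rintro i (q | q) hq
    · rw [abelian2BGA_HZ_inl] at hq
      refine ⟨_, hgb _ hq, ?_⟩
      simp only [pos, Sum.elim_inl]
      simp [mul_comm, mul_assoc, mul_left_comm]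
    · rw [abelian2BGA_HZ_inr] at hq
      refine ⟨_, hga _ hq, ?_⟩
      simp only [pos, Sum.elim_inr]
      simp [mul_comm, mul_assoc, mul_left_comm]
  refine CSSCode.minDistance_le_of_pos _ hdim pos (fun q => q.isLeft) ?_ ?_ hD g ?_ ?_
  · rintro (q | q) hq (q' | q') hq' h <;> simp_all [pos]
  · rintro (q | q) hq (q' | q') hq' h <;> simp_all [pos]
  · intro i q q' hq hq'
    obtain ⟨t, ht, h⟩ := hXpos i q hq
    obtain ⟨t', ht', h'⟩ := hXpos i q' hq'
    exact ⟨t, ht, t', ht', h.trans h'.symm⟩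
  · intro i q q' hq hq'
    obtain ⟨t, ht, h⟩ := hZpos i q hq
    obtain ⟨t', ht', h'⟩ := hZpos i q' hq'
    exact ⟨t', ht', t, ht, by rw [h, h', mul_right_comm]⟩

end

/-! ### The distance bound. -/

theorem theorem2 {G : Type*} [CommGroup G] [Fintype G] [DecidableEq G] (a b : G → ZMod 2)
    (hnontrivial : groupAlgebraMatrix a ≠ 0 ∨ groupAlgebraMatrix b ≠ 0)
    (hdim : 0 < (abelian2BGA a b).dimension)
    (w D : ℕ) (hD : 1 ≤ D) (hwD : w = D + 2)
    (hw : (abelian2BGA a b).HasGeneratorWeight w)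
    (n : ℕ) (hn : n = Fintype.card G)
    (hlarge : 8 * √(hermiteConstant D) ≤ (n : ℝ) ^ ((1 : ℝ) / D)) :
    ∃ d : ℕ, (abelian2BGA a b).minDistance = d ∧
      (d : ℝ) ≤ 2 * √(hermiteConstant D) * (√(D : ℝ) + 4) * (n : ℝ) ^ (((D : ℝ) - 1) / D) := by
  have hD1 : (1 : ℝ) ≤ D := by exact_mod_cast hD
  have hγ : 1 ≤ √(hermiteConstant D) := Real.one_le_sqrt.2 (one_le_hermiteConstant hD)
  have hsD : 1 ≤ √(D : ℝ) := Real.one_le_sqrt.2 hD1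
  have hn1 : (1 : ℝ) ≤ (n : ℝ) ^ (((D : ℝ) - 1) / D) := by
    refine Real.one_le_rpow ?_ (div_nonneg (by linarith) (by linarith))
    rw [hn]
    exact_mod_cast Fintype.card_pos
  have hbound : 10 * √(hermiteConstant D) * (n : ℝ) ^ (((D : ℝ) - 1) / D) ≤
      2 * √(hermiteConstant D) * (√(D : ℝ) + 4) * (n : ℝ) ^ (((D : ℝ) - 1) / D) := by
    refine mul_le_mul_of_nonneg_right ?_ (by linarith)
    nlinarith
  suffices h : ∃ d : ℕ, (abelian2BGA a b).minDistance ≤ d ∧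
      (d : ℝ) ≤ 10 * √(hermiteConstant D) * (n : ℝ) ^ (((D : ℝ) - 1) / D) by
    obtain ⟨d, h1, h2⟩ := h
    obtain ⟨d', hd', hle⟩ := ENat.le_natCast_iff.1 h1
    exact ⟨d', hd', le_trans (by exact_mod_cast hle) (h2.trans hbound)⟩
  by_cases h : a = 0 ∨ b = 0
  · refine ⟨1, abelian2BGA_minDistance_le_one a b hdim h, ?_⟩
    rw [Nat.cast_one]
    nlinarith
  · push Not at h
    rw [hn, ← Nat.card_eq_fintype_card]
    refine abelian2BGA_minDistance_le a b hdim h.1 h.2 hD ?_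
    rw [← hammingNorm_abelian2BGA_HX_row, (hw 1).1, hwD]
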